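/- All graphs are finite, simple and undirected. The degree sequence of a graph on $n$ vertices is the multiset of its $n$ vertex degrees (the order of the terms is irrelevant). A graph is biconnected if it is connected and the deletion of any one vertex does not disconnect it. Let $D_0(n)$ be the set of degree sequences of graphs on $n$ vertices (zero terms allowed), $D(n)$ the set of those sequences in $D_0(n)$ all of whose terms are positive, $D_2(n)$ the set of those in $D(n)$ all of whose terms are at least $2$, $S(n)$ the set of those in $D(n)$ whose largest term is exactly $n-2$, and $D_b(n)$ the set of degree sequences of biconnected graphs on $n$ vertices. Let $p(j)$ be the number of partitions of the integer $j\ge 0$ (with $p(0)=1$). Then for every integer $n\ge 5$, $$|D_2(n)| = |D(n)|-|D_0(n-2)|-|S(n)|$$ and $$|D_b(n)| = |D_2(n)|-\sum_{i=4}^{n-1} s_i,\qquad s_i=\begin{cases}\displaystyle\sum_{0\le j\le i-4,\ j\text{ even}}p(j) & \text{if } i \text{ is even},\\[2ex] \displaystyle\sum_{1\le j\le i-4,\ j\text{ odd}}p(j) & \text{if } i\text{ is odd}.\end{cases}$$ -/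

import Mathlib

namespace DegSeq

/-- The unordered degree sequence of a finite simple graph on the vertices `0, …, n - 1`. -/
noncomputable def degrees {n : ℕ} (G : SimpleGraph (Fin n)) : Multiset ℕ :=
  open Classical in (Finset.univ : Finset (Fin n)).val.map fun v => G.degree v

/-- A graph is biconnected if it is connected and has no cut vertex: deleting any one vertex
does not disconnect it. -/
def Biconnected {V : Type*} (G : SimpleGraph V) : Prop :=
  G.Connected ∧ ∀ v : V, (G.induce {v}ᶜ).Preconnected

/-- Degree sequences of length `n`, zero terms allowed. -/
def D₀ (n : ℕ) : Set (Multiset ℕ) :=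
  {s | ∃ G : SimpleGraph (Fin n), degrees G = s}

/-- Zero-free degree sequences of length `n`. -/
def D (n : ℕ) : Set (Multiset ℕ) :=
  {s | s ∈ D₀ n ∧ ∀ d ∈ s, 1 ≤ d}

/-- Degree sequences of length `n` whose smallest term is at least `2`. -/
def D₂ (n : ℕ) : Set (Multiset ℕ) :=
  {s | s ∈ D n ∧ ∀ d ∈ s, 2 ≤ d}

/-- Zero-free degree sequences of length `n` whose largest term is exactly `n - 2`
(for `n ≥ 2`). -/
def S (n : ℕ) : Set (Multiset ℕ) :=
  {s | s ∈ D n ∧ IsGreatest {d | d ∈ s} (n - 2)}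

/-- Degree sequences of biconnected graphs on `n` vertices. -/
def Db (n : ℕ) : Set (Multiset ℕ) :=
  {s | ∃ G : SimpleGraph (Fin n), Biconnected G ∧ degrees G = s}

/-- The partition function. -/
def p (j : ℕ) : ℕ := Fintype.card (Nat.Partition j)

/-- All the sets above are finite, so that `Set.ncard` is their true cardinality. -/
theorem finite_sets (n : ℕ) :
    (D₀ n).Finite ∧ (D n).Finite ∧ (D₂ n).Finite ∧ (S n).Finite ∧ (Db n).Finite := by
  have h : (D₀ n).Finite := Set.finite_range (degrees (n := n))
  exact ⟨h, h.subset fun _ hs => hs.1, h.subset fun _ hs => hs.1.1,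
    h.subset fun _ hs => hs.1.1, h.subset fun _ ⟨G, hG⟩ => ⟨G, hG.2⟩⟩

end DegSeq

/-!
Sequences with a term `1` account for the first identity: those with a dominating term `n - 1`
arise from a sequence in `D₀ (n - 2)` by adding an isolated vertex and then a dominating one, and
those without a dominating term are the complements of the sequences in `S n`.

For the second identity, a sequence with all terms at least `2` belongs to a biconnected graph if
and only if each term `i` satisfies `2 * n + 2 * i ≤ sum + 4`, that is, deleting a vertex of
degree `i` leaves at least `n - 2` edges, as many as a connected graph on `n - 1` vertices needs.
For sufficiency, suppose that `G - v` is disconnected with that many edges. Then one of its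
components contains a cycle, and, the degrees being at least `2`, any other component together
with `v` contains another one. A 2-switch of an edge of each of these disjoint cycles keeps the
degrees and strictly enlarges the relation "`x` and `y` are joined by a walk that avoids `u`", so
a realization with a maximal relation is biconnected. A sequence that violates the inequality
consists of one term `i` and `n - 1` terms which, reduced by `2`, are the parts of a partition of
some `j ≤ i - 4` with the parity of `i`, together with zeros; conversely such a sequence is
realized by joining a vertex to `i` vertices of a forest on the other `n - 1` vertices.
-/

namespace DegSeq

open SimpleGraph

section ReachableAvoiding

variable {V : Type*} {G H : SimpleGraph V} {u x y : V}

theorem reachable_of_forall_adj (h : ∀ x y, G.Adj x y → H.Reachable x y)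
    (hxy : G.Reachable x y) : H.Reachable x y := by
  obtain ⟨w⟩ := hxy
  induction w with
  | nil => exact .rfl
  | cons hadj _ ih => exact (h _ _ hadj).trans ih

/-- Two vertices are joined by a walk that avoids `u`. It is encoded as reachability after the
edges at `u` have been deleted, so that `u` itself is related to `u` only. -/
abbrev ReachableAvoiding (G : SimpleGraph V) (u x y : V) : Prop :=
  (G.deleteIncidenceSet u).Reachable x y

theorem reachableAvoiding_of_adj (h : G.Adj x y) (hx : x ≠ u) (hy : y ≠ u) :
    ReachableAvoiding G u x y :=
  (deleteIncidenceSet_adj.2 ⟨h, hx, hy⟩).reachable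

theorem ReachableAvoiding.eq_of_left (h : ReachableAvoiding G u u x) : x = u := by
  obtain ⟨w⟩ := h
  cases w with
  | nil => rfl
  | cons h _ => exact ((deleteIncidenceSet_adj.1 h).2.1 rfl).elim

theorem ReachableAvoiding.ne_right (h : ReachableAvoiding G u x y) (hx : x ≠ u) : y ≠ u := by
  rintro rfl
  exact hx (ReachableAvoiding.eq_of_left h.symm)

end ReachableAvoiding

section Forests

variable {V : Type*} {G : SimpleGraph V} {x y : V}

theorem card_edgeSet_add_one_le_of_isAcyclic [Finite V] [Nonempty V] (hG : G.IsAcyclic) :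
    Nat.card G.edgeSet + 1 ≤ Nat.card V := by
  obtain ⟨T, hGT, -, hT⟩ :=
    (connected_top (V := V)).exists_isTree_le_of_le_of_isAcyclic le_top hG
  rw [← (isTree_iff_connected_and_card.1 hT).2]
  exact Nat.succ_le_succ (Nat.card_mono T.edgeSet.toFinite (edgeSet_mono hGT))

theorem card_edgeSet_sup_edge [Finite V] (hxy : ¬ G.Adj x y) (hne : x ≠ y) :
    Nat.card (G ⊔ edge x y).edgeSet = Nat.card G.edgeSet + 1 := by
  classical
  have := Fintype.ofFinite V
  simpa only [edgeFinset_card, Nat.card_eq_fintype_card] using card_edgeFinset_sup_edge G hxy hne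

theorem card_edgeSet_add_two_le_of_isAcyclic [Finite V] (hG : G.IsAcyclic)
    (hxy : ¬ G.Reachable x y) :
    Nat.card G.edgeSet + 2 ≤ Nat.card V := by
  have : Nonempty V := ⟨x⟩
  have h := card_edgeSet_add_one_le_of_isAcyclic (hG.sup_edge_of_not_reachable hxy)
  rwa [card_edgeSet_sup_edge (fun h => hxy h.reachable) fun h => hxy (h ▸ .rfl)] at h

open Classical in
theorem not_isAcyclic_of_two_le_degree [Fintype V] {v w : V} (hvw : w ≠ v)
    (hdeg : ∀ x, x ≠ v → 2 ≤ G.degree x) : ¬ G.IsAcyclic := by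
  intro hG
  have hsum : G.degree v + 2 * (Fintype.card V - 1) ≤ 2 * Nat.card G.edgeSet := by
    rw [Nat.card_eq_fintype_card, ← edgeFinset_card, ← G.sum_degrees_eq_twice_card_edges,
      ← Finset.add_sum_erase _ _ (Finset.mem_univ v), ← Finset.card_univ,
      ← Finset.card_erase_of_mem (Finset.mem_univ v), mul_comm, ← smul_eq_mul]
    gcongr
    exact Finset.card_nsmul_le_sum _ _ _ fun x hx => hdeg x (Finset.ne_of_mem_erase hx)
  have hV : 0 < Fintype.card V := Fintype.card_pos_iff.2 ⟨v⟩
  rcases (G.degree v).eq_zero_or_pos with h0 | hpos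
  · have hvw : ¬ G.Reachable v w := fun h => by
      have := h.degree_pos_left hvw.symm
      omega
    have := card_edgeSet_add_two_le_of_isAcyclic hG hvw
    rw [Nat.card_eq_fintype_card (α := V)] at this
    omega
  · have : Nonempty V := ⟨v⟩
    have := card_edgeSet_add_one_le_of_isAcyclic hG
    rw [Nat.card_eq_fintype_card (α := V)] at this
    omega

end Forests

section Switch

variable {V : Type*} {G H : SimpleGraph V} {a b c d r t u x y : V}

/-- The 2-switch that replaces the edges `ab` and `cd` by `ac` and `bd`. -/
def switch (G : SimpleGraph V) (a b c d : V) : SimpleGraph V :=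
  G.deleteEdges {s(a, b), s(c, d)} ⊔ edge a c ⊔ edge b d

theorem switch_swap (G : SimpleGraph V) (a b c d : V) : switch G c d a b = switch G a b c d := by
  unfold switch
  rw [Set.pair_comm, edge_comm c, edge_comm d]

theorem mem_edgeSet_switch {e : Sym2 V} (he : e ∈ G.edgeSet) (hab : e ≠ s(a, b))
    (hcd : e ≠ s(c, d)) : e ∈ (switch G a b c d).edgeSet := by
  simp only [switch, edgeSet_sup, edgeSet_deleteEdges]
  exact .inl (.inl ⟨he, by simp [hab, hcd]⟩)

theorem switch_adj_left (hac : a ≠ c) : (switch G a b c d).Adj a c := by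
  simp [switch, edge_adj, hac]

theorem switch_adj_right (hbd : b ≠ d) : (switch G a b c d).Adj b d := by
  simp [switch, edge_adj, hbd]

theorem degree_sup_edge [DecidableEq V] {z : V} [Fintype (G.neighborSet z)]
    [Fintype ((G ⊔ edge x y).neighborSet z)] (hxy : ¬ G.Adj x y) (hne : x ≠ y) :
    (G ⊔ edge x y).degree z =
      G.degree z + (if z = x then 1 else 0) + (if z = y then 1 else 0) := by
  have hyx : ¬ G.Adj y x := fun h => hxy h.symm
  simp only [← card_neighborFinset_eq_degree]
  rcases eq_or_ne z x with rfl | hzx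
  · rw [if_pos rfl, if_neg hne, add_zero,
      ← Finset.card_insert_of_notMem (mt (mem_neighborFinset G z y).1 hxy)]
    congr 1
    ext w
    simp only [mem_neighborFinset, Finset.mem_insert, sup_adj, edge_adj]
    grind
  rcases eq_or_ne z y with rfl | hzy
  · rw [if_neg hzx, if_pos rfl, add_zero,
      ← Finset.card_insert_of_notMem (mt (mem_neighborFinset G z x).1 hyx)]
    congr 1
    ext w
    simp only [mem_neighborFinset, Finset.mem_insert, sup_adj, edge_adj]
    grind
  · rw [if_neg hzx, if_neg hzy, add_zero, add_zero]
    congr 1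
    ext w
    simp only [mem_neighborFinset, sup_adj, edge_adj]
    grind

theorem deleteEdges_pair_sup_edge_sup_edge (hab : G.Adj a b) (hcd : G.Adj c d) :
    G.deleteEdges {s(a, b), s(c, d)} ⊔ edge a b ⊔ edge c d = G := by
  ext x y
  simp only [sup_adj, deleteEdges_adj, edge_adj, Set.mem_insert_iff, Set.mem_singleton_iff,
    Sym2.eq_iff]
  grind [SimpleGraph.Adj.symm, SimpleGraph.Adj.ne]

open Classical in
theorem degree_switch [Fintype V] (hab : G.Adj a b) (hcd : G.Adj c d) (hac : a ≠ c)
    (hbd : b ≠ d) (nac : ¬ G.Adj a c) (nbd : ¬ G.Adj b d) (z : V) :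
    (switch G a b c d).degree z = G.degree z := by
  have had : a ≠ d := fun h => nac (h ▸ hcd.symm)
  have hbc : b ≠ c := fun h => nac (h ▸ hab)
  calc
    _ = (G.deleteEdges {s(a, b), s(c, d)} ⊔ edge a b ⊔ edge c d).degree z := by
      rw [switch, degree_sup_edge, degree_sup_edge, degree_sup_edge, degree_sup_edge]
      · ring
      all_goals
        grind [deleteEdges_adj, SimpleGraph.Adj.ne]
    _ = G.degree z := by
      congr!
      exact deleteEdges_pair_sup_edge_sup_edge hab hcd

theorem reachable_of_mem_edges_isCycle {p : G.Walk r r} (hp : p.IsCycle) (hab : s(a, b) ∈ p.edges)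
    (hH : ∀ e ∈ p.edges, e ≠ s(a, b) → e ∈ H.edgeSet) : H.Reachable a b := by
  have hab' := p.adj_of_mem_edges hab
  have hp' : ∀ e ∈ p.edges, e ∈ (H ⊔ edge a b).edgeSet := fun e he => by
    rw [edgeSet_sup, edgeSet_edge_of_ne hab'.ne]
    by_cases h : e = s(a, b)
    exacts [.inr h, .inl (hH e he h)]
  have := (adj_and_reachable_delete_edges_iff_exists_cycle (G := H ⊔ edge a b)).2
    ⟨r, _, hp.transfer hp', by rwa [Walk.edges_transfer]⟩
  refine this.2.mono fun x y hxy => ?_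
  simp only [deleteEdges_adj, sup_adj, Set.mem_singleton_iff, edge_adj, Sym2.eq_iff] at hxy
  tauto

theorem reachableAvoiding_switch_of_isCycle {p : G.Walk r r} (hp : p.IsCycle)
    (hab : s(a, b) ∈ p.edges) (hc : c ∉ p.support) (hu : u ∉ p.support) :
    ReachableAvoiding (switch G a b c d) u a b := by
  refine reachable_of_mem_edges_isCycle hp hab fun e he hne => ?_
  rw [edgeSet_deleteIncidenceSet]
  refine ⟨mem_edgeSet_switch (p.edges_subset_edgeSet he) hne ?_, fun h =>
    hu (Walk.mem_support_of_mem_edges he h.2)⟩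
  rintro rfl
  exact hc (p.fst_mem_support_of_mem_edges he)

/-- A deleted edge is bypassed along the rest of its own cycle, or, if `u` lies on that cycle,
along the new edges and the rest of the other one. -/
theorem reachableAvoiding_switch_of_mem_edges {p : G.Walk r r} {q : G.Walk t t} (hp : p.IsCycle)
    (hq : q.IsCycle) (hpq : p.support.Disjoint q.support) (hab : s(a, b) ∈ p.edges)
    (hcd : s(c, d) ∈ q.edges) (ha : a ≠ u) (hb : b ≠ u) :
    ReachableAvoiding (switch G a b c d) u a b := by
  have hap := p.fst_mem_support_of_mem_edges hab
  have hbp := p.snd_mem_support_of_mem_edges hab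
  have hcq := q.fst_mem_support_of_mem_edges hcd
  have hdq := q.snd_mem_support_of_mem_edges hcd
  by_cases hu : u ∈ p.support
  · have hac : ReachableAvoiding (switch G a b c d) u a c :=
      reachableAvoiding_of_adj (switch_adj_left fun h => hpq hap (h ▸ hcq)) ha
        fun h => hpq hu (h ▸ hcq)
    have hbd : ReachableAvoiding (switch G a b c d) u b d :=
      reachableAvoiding_of_adj (switch_adj_right fun h => hpq hbp (h ▸ hdq)) hb
        fun h => hpq hu (h ▸ hdq)
    have hcd : ReachableAvoiding (switch G c d a b) u c d :=
      reachableAvoiding_switch_of_isCycle hq hcd (hpq hap) (hpq hu)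
    exact hac.trans ((switch_swap G a b c d ▸ hcd).trans hbd.symm)
  · exact reachableAvoiding_switch_of_isCycle hp hab (fun h => hpq h hcq) hu

theorem reachableAvoiding_le_switch {p : G.Walk r r} {q : G.Walk t t} (hp : p.IsCycle)
    (hq : q.IsCycle) (hpq : p.support.Disjoint q.support) (hab : s(a, b) ∈ p.edges)
    (hcd : s(c, d) ∈ q.edges) :
    ReachableAvoiding G ≤ ReachableAvoiding (switch G a b c d) := by
  refine fun u x y => reachable_of_forall_adj fun x y hxy => ?_
  obtain ⟨hxy, hx, hy⟩ := deleteIncidenceSet_adj.1 hxy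
  by_cases e₁ : s(x, y) = s(a, b)
  · rw [← e₁] at hab
    rcases Sym2.eq_iff.1 e₁ with ⟨rfl, rfl⟩ | ⟨rfl, rfl⟩
    · exact reachableAvoiding_switch_of_mem_edges hp hq hpq hab hcd hx hy
    · rw [Sym2.eq_swap] at hab
      exact (reachableAvoiding_switch_of_mem_edges hp hq hpq hab hcd hy hx).symm
  by_cases e₂ : s(x, y) = s(c, d)
  · rw [← switch_swap]
    rw [← e₂] at hcd
    rcases Sym2.eq_iff.1 e₂ with ⟨rfl, rfl⟩ | ⟨rfl, rfl⟩
    · exact reachableAvoiding_switch_of_mem_edges hq hp hpq.symm hcd hab hx hy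
    · rw [Sym2.eq_swap] at hcd
      exact (reachableAvoiding_switch_of_mem_edges hq hp hpq.symm hcd hab hy hx).symm
  · exact reachableAvoiding_of_adj (mem_edgeSet_switch hxy e₁ e₂) hx hy

end Switch

section DisjointCycles

variable {V : Type*} {G : SimpleGraph V} {r t u v x y z : V}

theorem exists_mem_edges_ne_ne_of_isCycle {p : G.Walk r r} (hp : p.IsCycle) (v : V) :
    ∃ c d, s(c, d) ∈ p.edges ∧ c ≠ v ∧ d ≠ v := by
  classical
  by_cases hv : v ∈ p.support
  · suffices ∀ q : G.Walk v v, q.IsCycle → ∃ c d, s(c, d) ∈ q.edges ∧ c ≠ v ∧ d ≠ v by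
      obtain ⟨c, d, hcd, hne⟩ := this _ (hp.rotate hv)
      exact ⟨c, d, (p.rotate_edges v hv).mem_iff.1 hcd, hne⟩
    intro q hq
    match q with
    | .nil => exact (Walk.not_isCycle_nil hq).elim
    | .cons h .nil => exact (h.ne rfl).elim
    | .cons (v := x) h (.cons (v := y) h' q) =>
      refine ⟨x, y, by simp, h.ne', ?_⟩
      rintro rfl
      simpa [Sym2.eq_swap] using hq.edges_nodup
  · match p with
    | .nil => exact (Walk.not_isCycle_nil hp).elim
    | .cons (v := x) h q =>
      refine ⟨r, x, by simp, ?_, ?_⟩ <;> rintro rfl <;> simp at hv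

theorem reachableAvoiding_of_mem_support {p : G.Walk r t} (hu : u ∉ p.support)
    (hz : z ∈ p.support) : ReachableAvoiding G u r z := by
  classical
  have hp : ∀ e ∈ p.edges, e ∈ (G.deleteIncidenceSet u).edgeSet := fun e he => by
    rw [edgeSet_deleteIncidenceSet]
    exact ⟨p.edges_subset_edgeSet he, fun h => hu (Walk.mem_support_of_mem_edges he h.2)⟩
  exact ((p.transfer _ hp).takeUntil z (by rwa [Walk.support_transfer])).reachable

/-- If `G - v` were a forest, adding the edge `xy` to it would leave a forest in which `v` is
isolated. -/
theorem exists_isCycle_notMem_support [Finite V] (hx : x ≠ v) (hy : y ≠ v)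
    (hxy : ¬ ReachableAvoiding G v x y)
    (hcard : Nat.card V ≤ Nat.card (G.deleteIncidenceSet v).edgeSet + 2) :
    ∃ (r : V) (p : G.Walk r r), p.IsCycle ∧ v ∉ p.support := by
  classical
  set H := G.deleteIncidenceSet v with hH
  have hcyc : ¬ H.IsAcyclic := fun hac => by
    have hvx : ¬ (H ⊔ edge x y).Reachable v x := by
      rintro ⟨w⟩
      cases w with
      | nil => exact hx rfl
      | cons h _ =>
        rcases h with h | h
        · exact (deleteIncidenceSet_adj.1 h).2.1 rfl
        · grind
    have := card_edgeSet_add_two_le_of_isAcyclic (hac.sup_edge_of_not_reachable hxy) hvx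
    rw [card_edgeSet_sup_edge (fun h => hxy h.reachable) fun h => hxy (h ▸ .rfl)] at this
    rw [hH] at hcard
    omega
  simp only [IsAcyclic, not_forall, not_not] at hcyc
  obtain ⟨r, p, hp⟩ := hcyc
  refine ⟨r, p.mapLe (deleteIncidenceSet_le G v), hp.mapLe _, fun hv => ?_⟩
  rw [Walk.support_mapLe_eq_support] at hv
  have hr : r ≠ v := (deleteIncidenceSet_adj.1 (p.adj_snd hp.not_nil)).2.1
  exact ReachableAvoiding.ne_right (p.takeUntil v hv).reachable hr rfl

open Classical in
theorem exists_isCycle_support_subset [Fintype V] (hdeg : ∀ x, 2 ≤ G.degree x) (hz : z ≠ v) :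
    ∃ (t : V) (q : G.Walk t t), q.IsCycle ∧
      ∀ w ∈ q.support, w = v ∨ ReachableAvoiding G v z w := by
  set s : Set V := insert v {x | ReachableAvoiding G v z x}
  have hnbr : ∀ x ∈ s, x ≠ v → G.neighborSet x ⊆ s := fun x hx hxv y hxy => by
    by_cases hy : y = v
    · exact .inl hy
    · exact .inr ((hx.resolve_left hxv).trans (reachableAvoiding_of_adj hxy hxv hy))
  have hcyc : ¬ (G.induce s).IsAcyclic :=
    not_isAcyclic_of_two_le_degree (v := ⟨v, .inl rfl⟩) (w := ⟨z, .inr .rfl⟩)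
      (fun h => hz (congrArg Subtype.val h)) fun x hx => by
        convert hdeg x using 1
        convert degree_induce_of_neighborSet_subset (hnbr x x.2 fun h => hx (Subtype.ext h))
  simp only [IsAcyclic, not_forall, not_not] at hcyc
  obtain ⟨t, q, hq⟩ := hcyc
  refine ⟨t, q.map (Embedding.induce s).toHom, hq.map Subtype.val_injective, fun w hw => ?_⟩
  obtain ⟨w, -, rfl⟩ := List.mem_map.1 (q.support_map _ ▸ hw)
  exact w.2

open Classical in
theorem exists_reachableAvoiding_lt [Fintype V] (hdeg : ∀ x, 2 ≤ G.degree x)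
    (hcard : Nat.card V ≤ Nat.card (G.deleteIncidenceSet v).edgeSet + 2)
    (hx : x ≠ v) (hy : y ≠ v) (hxy : ¬ ReachableAvoiding G v x y) :
    ∃ G' : SimpleGraph V, (∀ z, G'.degree z = G.degree z) ∧
      ReachableAvoiding G < ReachableAvoiding G' := by
  obtain ⟨r, p, hp, hvp⟩ := exists_isCycle_notMem_support hx hy hxy hcard
  have hpr : ∀ w ∈ p.support, ReachableAvoiding G v r w := fun w =>
    reachableAvoiding_of_mem_support hvp
  obtain ⟨z, hz, hrz⟩ : ∃ z, z ≠ v ∧ ¬ ReachableAvoiding G v r z := by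
    by_contra! hcon
    exact hxy ((hcon x hx).symm.trans (hcon y hy))
  obtain ⟨t, q, hq, hqz⟩ := exists_isCycle_support_subset hdeg hz
  obtain ⟨a, b, hab, ha, hb⟩ := exists_mem_edges_ne_ne_of_isCycle hp v
  obtain ⟨c, d, hcd, hc, hd⟩ := exists_mem_edges_ne_ne_of_isCycle hq v
  have hsep : ∀ f ∈ p.support, ∀ g ∈ q.support, g ≠ v → ¬ ReachableAvoiding G v f g :=
    fun f hf g hg hgv h =>
      hrz ((hpr f hf).trans (h.trans ((hqz g hg).resolve_left hgv).symm))
  have hpq : p.support.Disjoint q.support := fun _ hw hw' =>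
    hsep _ hw _ hw' (fun h => hvp (h ▸ hw)) .rfl
  have hap := p.fst_mem_support_of_mem_edges hab
  have hbp := p.snd_mem_support_of_mem_edges hab
  have hcq := q.fst_mem_support_of_mem_edges hcd
  have hdq := q.snd_mem_support_of_mem_edges hcd
  have hac : a ≠ c := fun h => hpq hap (h ▸ hcq)
  have hbd : b ≠ d := fun h => hpq hbp (h ▸ hdq)
  refine ⟨switch G a b c d, degree_switch (p.adj_of_mem_edges hab) (q.adj_of_mem_edges hcd) hac hbd
    (fun h => hsep a hap c hcq hc (reachableAvoiding_of_adj h ha hc))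
    (fun h => hsep b hbp d hdq hd (reachableAvoiding_of_adj h hb hd)),
    reachableAvoiding_le_switch hp hq hpq hab hcd, fun hle => ?_⟩
  exact hsep a hap c hcq hc (hle v a c (reachableAvoiding_of_adj (switch_adj_left hac) ha hc))

end DisjointCycles

section Biconnected

variable {V : Type*} {G : SimpleGraph V} {v x y : V}

theorem ReachableAvoiding.reachable_induce (hx : x ∈ ({v}ᶜ : Set V)) (hy : y ∈ ({v}ᶜ : Set V))
    (h : ReachableAvoiding G v x y) : (G.induce {v}ᶜ).Reachable ⟨x, hx⟩ ⟨y, hy⟩ := by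
  obtain ⟨w⟩ := h
  induction w with
  | nil => exact .rfl
  | @cons x z y hxz _ ih =>
    obtain ⟨hxz, -, hz⟩ := deleteIncidenceSet_adj.1 hxz
    exact (show (G.induce {v}ᶜ).Adj ⟨x, hx⟩ ⟨z, hz⟩ from hxz).reachable.trans (ih hz hy)

theorem biconnected_of_reachableAvoiding (hV : 3 ≤ ENat.card V)
    (h : ∀ v x y, x ≠ v → y ≠ v → ReachableAvoiding G v x y) : Biconnected G := by
  have : Nonempty V := by
    rw [← ENat.one_le_card_iff_nonempty]
    exact le_trans (by norm_num) hV
  refine ⟨⟨fun x y => ?_⟩, fun v x y => (h v x y x.2 y.2).reachable_induce x.2 y.2⟩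
  obtain ⟨z, hzx, hzy⟩ := ENat.exists_ne_ne_of_three_le hV x y
  exact (h z x y hzx.symm hzy.symm).mono (deleteIncidenceSet_le G z)

open Classical in
theorem Biconnected.two_le_degree [Fintype V] (hV : 3 ≤ ENat.card V) (hG : Biconnected G) (x : V) :
    2 ≤ G.degree x := by
  obtain ⟨z, hzx, -⟩ := ENat.exists_ne_ne_of_three_le hV x x
  have : Nontrivial V := ⟨z, x, hzx⟩
  obtain ⟨w, hw⟩ := hG.1.preconnected.exists_adj_of_nontrivial x
  obtain ⟨z, hzx, hzw⟩ := ENat.exists_ne_ne_of_three_le hV x w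
  have : Nontrivial ({w}ᶜ : Set V) :=
    ⟨⟨x, hw.ne⟩, ⟨z, hzw⟩, fun h => hzx (congrArg Subtype.val h).symm⟩
  obtain ⟨y, hy⟩ := (hG.2 w).exists_adj_of_nontrivial ⟨x, hw.ne⟩
  rw [← card_neighborFinset_eq_degree]
  exact Finset.one_lt_card.2 ⟨w, by simpa using hw, y, by simpa using hy, Ne.symm y.2⟩

open Classical in
theorem card_edgeSet_deleteIncidenceSet_add_degree [Fintype V] (G : SimpleGraph V) (v : V) :
    Nat.card (G.deleteIncidenceSet v).edgeSet + G.degree v = Nat.card G.edgeSet := by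
  have h := card_edgeFinset_deleteIncidenceSet G v
  have hle := G.degree_le_card_edgeFinset v
  simp only [edgeFinset_card, ← Nat.card_eq_fintype_card] at h hle
  omega

open Classical in
theorem Biconnected.card_add_degree_le [Fintype V] [Nontrivial V] (hG : Biconnected G) (v : V) :
    Nat.card V + G.degree v ≤ Nat.card G.edgeSet + 2 := by
  have hconn : (G.induce {v}ᶜ).Connected :=
    { preconnected := hG.2 v, nonempty := let ⟨y, hy⟩ := exists_ne v; ⟨y, hy⟩ }
  have hle := hconn.card_vert_le_card_edgeSet_add_one
  have hedge := card_edgeFinset_induce_compl_singleton G v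
  have hdel := card_edgeSet_deleteIncidenceSet_add_degree G v
  have hvert : Nat.card ({v}ᶜ : Set V) + 1 = Nat.card V := by
    rw [Nat.card_coe_set_eq, ← Set.ncard_singleton v, add_comm, Set.ncard_add_ncard_compl]
  simp only [edgeFinset_card, ← Nat.card_eq_fintype_card] at hedge
  omega

open Classical in
theorem exists_biconnected_degree_eq [Fintype V] (hV : 3 ≤ ENat.card V) {G₀ : SimpleGraph V}
    (hdeg : ∀ x, 2 ≤ G₀.degree x)
    (hcard : ∀ v, Nat.card V + G₀.degree v ≤ Nat.card G₀.edgeSet + 2) :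
    ∃ G : SimpleGraph V, Biconnected G ∧ ∀ z, G.degree z = G₀.degree z := by
  obtain ⟨G, hG⟩ :=
    (Set.toFinite {G : SimpleGraph V | ∀ z, G.degree z = G₀.degree z}).exists_maximalFor
      ReachableAvoiding _ ⟨G₀, fun _ => rfl⟩
  have hd : ∀ z, G.degree z = G₀.degree z := hG.prop
  refine ⟨G, biconnected_of_reachableAvoiding hV fun v x y hx hy => ?_, hd⟩
  by_contra hxy
  have hedge : Nat.card G.edgeSet = Nat.card G₀.edgeSet := by
    have h := G.sum_degrees_eq_twice_card_edges
    rw [Finset.sum_congr rfl fun z _ => hd z, sum_degrees_eq_twice_card_edges] at h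
    simp only [edgeFinset_card, ← Nat.card_eq_fintype_card] at h
    omega
  have hdel := card_edgeSet_deleteIncidenceSet_add_degree G v
  have hv := hcard v
  rw [← hd v, ← hedge] at hv
  obtain ⟨G', hd', hlt⟩ :=
    exists_reachableAvoiding_lt (fun z => (hdeg z).trans_eq (hd z).symm) (by omega) hx hy hxy
  exact hG.not_prop_of_gt hlt fun z => (hd' z).trans (hd z)

end Biconnected

section Degrees

variable {n : ℕ} {s t : Multiset ℕ} {d : ℕ}

open Classical in
theorem mem_degrees {G : SimpleGraph (Fin n)} : d ∈ degrees G ↔ ∃ v, G.degree v = d := by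
  simp [degrees]

theorem card_degrees (G : SimpleGraph (Fin n)) : (degrees G).card = n := by
  simp [degrees]

theorem sum_degrees (G : SimpleGraph (Fin n)) : (degrees G).sum = 2 * Nat.card G.edgeSet := by
  classical
  rw [Nat.card_eq_fintype_card, ← edgeFinset_card, ← sum_degrees_eq_twice_card_edges]
  rfl

theorem card_of_mem_D₀ (hs : s ∈ D₀ n) : s.card = n := by
  obtain ⟨G, rfl⟩ := hs
  exact card_degrees G

theorem even_sum_of_mem_D₀ (hs : s ∈ D₀ n) : Even s.sum := by
  obtain ⟨G, rfl⟩ := hs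
  exact sum_degrees G ▸ even_two_mul _

theorem lt_of_mem_D₀ (hs : s ∈ D₀ n) (hd : d ∈ s) : d < n := by
  classical
  obtain ⟨G, rfl⟩ := hs
  obtain ⟨v, rfl⟩ := mem_degrees.1 hd
  simpa using G.degree_lt_card_verts v

theorem mem_Db_iff (hn : 3 ≤ n) : s ∈ Db n ↔ s ∈ D₂ n ∧ ∀ i ∈ s, 2 * n + 2 * i ≤ s.sum + 4 := by
  classical
  have hV : 3 ≤ ENat.card (Fin n) := by simpa using hn
  constructor
  · rintro ⟨G, hG, rfl⟩
    have : Nontrivial (Fin n) := Fin.nontrivial_iff_two_le.2 (by omega)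
    have htwo : ∀ d ∈ degrees G, 2 ≤ d := fun d hd => by
      obtain ⟨v, rfl⟩ := mem_degrees.1 hd
      exact hG.two_le_degree hV v
    refine ⟨⟨⟨⟨G, rfl⟩, fun d hd => one_le_two.trans (htwo d hd)⟩, htwo⟩, fun i hi => ?_⟩
    obtain ⟨v, rfl⟩ := mem_degrees.1 hi
    have := hG.card_add_degree_le v
    rw [Nat.card_fin] at this
    rw [sum_degrees]
    omega
  · rintro ⟨⟨⟨⟨G₀, rfl⟩, -⟩, htwo⟩, hsum⟩
    obtain ⟨G, hG, hd⟩ := exists_biconnected_degree_eq hV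
      (fun x => htwo _ (mem_degrees.2 ⟨x, rfl⟩)) fun v => by
        have := hsum _ (mem_degrees.2 ⟨v, rfl⟩)
        rw [sum_degrees] at this
        rw [Nat.card_fin]
        omega
    exact ⟨G, hG, Multiset.map_congr rfl fun z _ => hd z⟩

end Degrees

section VertexAddition

variable {n d : ℕ} {s s₁ s₂ t : Multiset ℕ}

open Classical in
theorem degree_eq_sum_ite {V : Type*} [Fintype V] (G : SimpleGraph V) (v : V) :
    G.degree v = ∑ w, if G.Adj v w then 1 else 0 := by
  simpa only [Nat.cast_id] using degree_eq_sum_if_adj (R := ℕ) G v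

open Classical in
theorem degrees_eq_cons {G : SimpleGraph (Fin (n + 1))} {H : SimpleGraph (Fin n)}
    {v : Fin (n + 1)} (hH : G.comap v.succAbove = H) :
    degrees G = G.degree v ::ₘ (Finset.univ : Finset (Fin n)).val.map fun w =>
      H.degree w + if G.Adj v (v.succAbove w) then 1 else 0 := by
  rw [degrees, Fin.univ_succAbove n v, Finset.cons_val, Multiset.map_cons, Finset.map_val,
    Multiset.map_map]
  congr 1
  refine Multiset.map_congr rfl fun w _ => ?_
  rw [Function.comp_apply, Fin.coe_succAboveEmb, degree_eq_sum_ite, degree_eq_sum_ite,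
    Fin.sum_univ_succAbove _ v, add_comm]
  simp only [← hH, comap_adj, adj_comm]

/-- The graph obtained from `G` by adding a new vertex `0` with neighbourhood `T`; the old vertex
`x` becomes `x.succ`. -/
def addVertex (G : SimpleGraph (Fin n)) (T : Finset (Fin n)) : SimpleGraph (Fin (n + 1)) where
  Adj x y := Fin.cases (Fin.cases False (fun b => b ∈ T) y)
    (fun a => Fin.cases (a ∈ T) (fun b => G.Adj a b) y) x
  symm := ⟨fun x y => by
    cases x using Fin.cases <;> cases y using Fin.cases <;> simp [adj_comm]⟩
  loopless := ⟨fun x => by cases x using Fin.cases <;> simp⟩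

open Classical in
theorem degrees_addVertex (G : SimpleGraph (Fin n)) (T : Finset (Fin n)) :
    degrees (addVertex G T) =
      T.card ::ₘ (T.val.map (fun w => G.degree w + 1) + Tᶜ.val.map fun w => G.degree w) := by
  have hcomap : (addVertex G T).comap (Fin.succAbove 0) = G := by ext; simp [addVertex]
  have hadj (w : Fin n) : (addVertex G T).Adj 0 (Fin.succAbove 0 w) ↔ w ∈ T := by
    simp [addVertex]
  have hzero : (addVertex G T).degree 0 = T.card := by
    rw [degree_eq_sum_ite, Fin.sum_univ_succAbove _ 0, if_neg (addVertex G T).irrefl, zero_add]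
    simp only [hadj, Finset.sum_boole, Finset.filter_univ_mem, Nat.cast_id]
  have huniv : (Finset.univ : Finset (Fin n)).val = T.val + Tᶜ.val := by
    rw [← Finset.disjUnion_val _ _ disjoint_compl_right, Finset.disjUnion_eq_union,
      Finset.union_compl]
  rw [degrees_eq_cons hcomap, hzero, huniv, Multiset.map_add]
  simp only [hadj]
  congr 2
  · exact Multiset.map_congr rfl fun w hw => by rw [if_pos (show w ∈ T from hw)]
  · exact Multiset.map_congr rfl fun w hw => by
      rw [if_neg (Finset.mem_compl.1 hw), add_zero]

theorem exists_finset_map_eq_of_le {α β : Type*} {f : α → β} {t : Finset α} {s : Multiset β}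
    (h : s ≤ t.val.map f) : ∃ u ⊆ t, u.val.map f = s := by
  have hs : s ∈ Multiset.powersetCard s.card (t.val.map f) := Multiset.mem_powersetCard.2 ⟨h, rfl⟩
  rw [Multiset.powersetCard_map, Multiset.mem_map] at hs
  obtain ⟨u, hu, rfl⟩ := hs
  have hut := (Multiset.mem_powersetCard.1 hu).1
  exact ⟨⟨u, Multiset.nodup_of_le hut t.nodup⟩, Finset.val_le_iff.1 hut, rfl⟩

theorem card_cons_map_succ_add_mem_D₀ (h : s₁ + s₂ ∈ D₀ n) :
    s₁.card ::ₘ (s₁.map (· + 1) + s₂) ∈ D₀ (n + 1) := by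
  classical
  obtain ⟨G, hG⟩ := h
  obtain ⟨T, -, rfl⟩ := exists_finset_map_eq_of_le (hG ▸ Multiset.le_add_right s₁ s₂)
  have hT : Tᶜ.val.map (fun v => G.degree v) = s₂ := by
    rw [← add_right_inj, ← hG, degrees, ← Multiset.map_add,
      ← Finset.disjUnion_val _ _ disjoint_compl_right, Finset.disjUnion_eq_union,
      Finset.union_compl]
  refine ⟨addVertex G T, ?_⟩
  rw [degrees_addVertex, hT, Multiset.map_map, Multiset.card_map]
  rfl

theorem cons_map_succ_mem_D₀ (h : t ∈ D₀ n) : n ::ₘ t.map (· + 1) ∈ D₀ (n + 1) := by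
  have := card_cons_map_succ_add_mem_D₀ (s₁ := t) (s₂ := 0) (by rwa [add_zero])
  rwa [card_of_mem_D₀ h, add_zero] at this

theorem zero_cons_mem_D₀ (h : t ∈ D₀ n) : 0 ::ₘ t ∈ D₀ (n + 1) := by
  simpa using card_cons_map_succ_add_mem_D₀ (s₁ := 0) (s₂ := t) (by simpa using h)

theorem one_cons_succ_cons_mem_D₀ (h : d ::ₘ t ∈ D₀ n) : 1 ::ₘ (d + 1) ::ₘ t ∈ D₀ (n + 1) := by
  simpa using card_cons_map_succ_add_mem_D₀ (s₁ := {d}) (s₂ := t) (by simpa using h)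

theorem exists_eq_cons_map_succ (h : s ∈ D₀ (n + 1)) (hn : n ∈ s) :
    ∃ t ∈ D₀ n, s = n ::ₘ t.map (· + 1) := by
  classical
  obtain ⟨G, rfl⟩ := h
  obtain ⟨v, hv⟩ := mem_degrees.1 hn
  refine ⟨_, ⟨G.comap v.succAbove, rfl⟩, ?_⟩
  rw [degrees_eq_cons (v := v) rfl, degrees, Multiset.map_map, hv]
  congr 1
  refine Multiset.map_congr rfl fun w _ => ?_
  have : G.Adj v (v.succAbove w) :=
    (degree_eq_card_sub_one G v).1 (by simpa using hv) (Fin.succAbove_ne v w).symm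
  simp [this]

theorem exists_eq_zero_cons (h : s ∈ D₀ (n + 1)) (h0 : 0 ∈ s) : ∃ t ∈ D₀ n, s = 0 ::ₘ t := by
  classical
  obtain ⟨G, rfl⟩ := h
  obtain ⟨v, hv⟩ := mem_degrees.1 h0
  refine ⟨_, ⟨G.comap v.succAbove, rfl⟩, ?_⟩
  rw [degrees_eq_cons (v := v) rfl, degrees, hv]
  congr 1
  refine Multiset.map_congr rfl fun w _ => ?_
  have : ¬ G.Adj v (v.succAbove w) := fun h => h.degree_pos_left.ne' hv
  simp [this]

end VertexAddition

section Complement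

variable {n : ℕ} {s : Multiset ℕ}

/-- The degree sequence of the complement of a graph on `n` vertices with degree sequence `s`. -/
def complSeq (n : ℕ) (s : Multiset ℕ) : Multiset ℕ :=
  s.map (n - 1 - ·)

theorem complSeq_mem_D₀ (h : s ∈ D₀ n) : complSeq n s ∈ D₀ n := by
  classical
  obtain ⟨G, rfl⟩ := h
  refine ⟨Gᶜ, ?_⟩
  rw [complSeq, degrees, degrees, Multiset.map_map]
  exact Multiset.map_congr rfl fun w _ => by simp [degree_compl]

theorem complSeq_complSeq (h : ∀ d ∈ s, d < n) : complSeq n (complSeq n s) = s := by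
  rw [complSeq, complSeq, Multiset.map_map]
  conv_rhs => rw [← Multiset.map_id s]
  refine Multiset.map_congr rfl fun d hd => ?_
  have := h d hd
  simp only [Function.comp_apply, id]
  omega

end Complement

section ForestSequences

variable {n : ℕ} {t : Multiset ℕ}

theorem replicate_one_mem_D₀ (hn : Even n) : Multiset.replicate n 1 ∈ D₀ n := by
  obtain ⟨k, rfl⟩ := hn
  induction k with
  | zero => exact ⟨⊥, Multiset.card_eq_zero.1 (card_degrees _)⟩
  | succ k ih =>
    rw [show k + 1 + (k + 1) = k + k + 1 + 1 by ring]
    simpa only [Multiset.replicate_succ, zero_add] using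
      one_cons_succ_cons_mem_D₀ (zero_cons_mem_D₀ ih)

theorem mem_D₀_card_of_sum_lt (hpos : ∀ d ∈ t, 1 ≤ d) (heven : Even t.sum)
    (hsum : t.sum < 2 * t.card) : t ∈ D₀ t.card := by
  induction hn : t.card generalizing t with
  | zero => omega
  | succ n ih =>
  by_cases hone : ∀ d ∈ t, d = 1
  · obtain rfl := Multiset.eq_replicate.2 ⟨hn, hone⟩
    exact replicate_one_mem_D₀ (by simpa [add_comm] using heven)
  · push Not at hone
    obtain ⟨x, hxt, hx⟩ := hone
    obtain ⟨y, rfl⟩ : ∃ y, x = y + 1 + 1 := ⟨x - 2, by have := hpos x hxt; omega⟩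
    obtain ⟨r, rfl⟩ := Multiset.exists_cons_of_mem hxt
    have h1 : 1 ∈ r := by
      by_contra h1
      have : r.card • 2 ≤ r.sum := Multiset.card_nsmul_le_sum fun d hd =>
        (hpos d (Multiset.mem_cons_of_mem hd)).lt_of_ne' fun h => h1 (h ▸ hd)
      simp only [Multiset.card_cons, Multiset.sum_cons, smul_eq_mul] at *
      omega
    obtain ⟨q, rfl⟩ := Multiset.exists_cons_of_mem h1
    simp only [Multiset.card_cons, Multiset.sum_cons, Nat.even_iff] at hsum heven hn
    rw [Multiset.cons_swap]
    refine one_cons_succ_cons_mem_D₀ (ih (t := (y + 1) ::ₘ q) (fun d hd => ?_) ?_ ?_ ?_)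
    · rcases Multiset.mem_cons.1 hd with rfl | hd
      · omega
      · exact hpos d (by simp [hd])
    all_goals simp only [Multiset.card_cons, Multiset.sum_cons, Nat.even_iff]; omega

end ForestSequences

section TermOne

variable {n : ℕ} {s : Multiset ℕ}

theorem D_diff_D₂ : D n \ D₂ n = {s ∈ D n | 1 ∈ s} := by
  ext s
  refine and_congr_right fun hs => ⟨fun h => ?_, fun h1 h => absurd (h.2 1 h1) (by decide)⟩
  by_contra h1
  exact h ⟨hs, fun d hd => (hs.2 d hd).lt_of_ne' fun hd1 => h1 (hd1 ▸ hd)⟩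

theorem complSeq_mem_S (hn : 3 ≤ n) (hs : s ∈ D n) (h1 : 1 ∈ s) (hdom : n - 1 ∉ s) :
    complSeq n s ∈ S n := by
  refine ⟨⟨complSeq_mem_D₀ hs.1, fun d hd => ?_⟩, Multiset.mem_map.2 ⟨1, h1, by omega⟩,
    fun d hd => ?_⟩
  · obtain ⟨e, he, rfl⟩ := Multiset.mem_map.1 hd
    have := lt_of_mem_D₀ hs.1 he
    have : e ≠ n - 1 := fun h => hdom (h ▸ he)
    omega
  · obtain ⟨e, he, rfl⟩ := Multiset.mem_map.1 hd
    have := hs.2 e he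
    omega

theorem complSeq_mem_of_mem_S (hn : 3 ≤ n) (hs : s ∈ S n) :
    complSeq n s ∈ D n ∧ 1 ∈ complSeq n s ∧ n - 1 ∉ complSeq n s := by
  obtain ⟨⟨h0, hpos⟩, hmem, hmax⟩ := hs
  refine ⟨⟨complSeq_mem_D₀ h0, fun d hd => ?_⟩, Multiset.mem_map.2 ⟨n - 2, hmem, by omega⟩,
    fun hd => ?_⟩
  · obtain ⟨e, he, rfl⟩ := Multiset.mem_map.1 hd
    have : e ≤ n - 2 := hmax he
    omega
  · obtain ⟨e, he, h⟩ := Multiset.mem_map.1 hd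
    have := hpos e he
    omega

theorem ncard_one_mem_diff_dominating (hn : 3 ≤ n) :
    ({s ∈ D n | 1 ∈ s} \ {s | n - 1 ∈ s}).ncard = (S n).ncard := by
  have hinv : Set.InvOn (complSeq n) (complSeq n) ({s ∈ D n | 1 ∈ s} \ {s | n - 1 ∈ s}) (S n) :=
    ⟨fun s hs => complSeq_complSeq fun _ => lt_of_mem_D₀ hs.1.1.1,
      fun s hs => complSeq_complSeq fun _ => lt_of_mem_D₀ hs.1.1⟩
  refine (hinv.bijOn (fun s hs => complSeq_mem_S hn hs.1.1 hs.1.2 hs.2) fun s hs => ?_).ncard_eq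
  obtain ⟨hD, h1, hdom⟩ := complSeq_mem_of_mem_S hn hs
  exact ⟨⟨hD, h1⟩, hdom⟩

theorem one_mem_inter_dominating_eq_image (N : ℕ) :
    {s ∈ D (N + 2) | 1 ∈ s} ∩ {s | N + 1 ∈ s} =
      (fun t : Multiset ℕ => (N + 1) ::ₘ 1 ::ₘ t.map (· + 1)) '' D₀ N := by
  ext s
  constructor
  · rintro ⟨⟨⟨h0, -⟩, h1⟩, hdom⟩
    obtain ⟨t, ht, rfl⟩ := exists_eq_cons_map_succ h0 hdom
    have h0t : 0 ∈ t := by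
      rcases Multiset.mem_cons.1 h1 with h | h
      · obtain rfl : N = 0 := by omega
        obtain ⟨a, rfl⟩ := Multiset.card_eq_one.1 (card_of_mem_D₀ ht)
        exact Multiset.mem_singleton.2
          (Nat.lt_one_iff.1 (lt_of_mem_D₀ ht (Multiset.mem_singleton_self a))).symm
      · simpa using h
    obtain ⟨u, hu, rfl⟩ := exists_eq_zero_cons ht h0t
    exact ⟨u, hu, by simp⟩
  · rintro ⟨t, ht, rfl⟩
    refine ⟨⟨⟨?_, fun d hd => ?_⟩, by simp⟩, by simp⟩
    · simpa using cons_map_succ_mem_D₀ (zero_cons_mem_D₀ ht)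
    · simp only [Multiset.mem_cons, Multiset.mem_map] at hd
      omega

theorem ncard_one_mem_inter_dominating (N : ℕ) :
    ({s ∈ D (N + 2) | 1 ∈ s} ∩ {s | N + 1 ∈ s}).ncard = (D₀ N).ncard := by
  rw [one_mem_inter_dominating_eq_image]
  refine Set.ncard_image_of_injective _ fun s t h => ?_
  simp only [Multiset.cons_inj_right] at h
  exact Multiset.map_injective (add_left_injective 1) h

theorem ncard_D_eq (hn : 3 ≤ n) :
    (D n).ncard = (D₂ n).ncard + ((D₀ (n - 2)).ncard + (S n).ncard) := by
  obtain ⟨N, rfl⟩ := Nat.exists_eq_add_of_le' ((Nat.le_succ 2).trans hn)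
  have hfin := (finite_sets (N + 2)).2.1
  have hsub : D₂ (N + 2) ⊆ D (N + 2) := fun s hs => hs.1
  rw [← Set.ncard_sdiff_add_ncard_of_subset hsub hfin, D_diff_D₂, add_comm,
    ← Set.ncard_inter_add_ncard_sdiff_eq_ncard _ {s | N + 1 ∈ s} (hfin.subset (Set.sep_subset _ _)),
    ncard_one_mem_inter_dominating, ← ncard_one_mem_diff_dominating hn]
  rfl

end TermOne

section HubSequences

variable {n i i' d : ℕ} {q q' s : Multiset ℕ}

/-- The sequence with a term `i` whose other terms are `d + 2` for `d` in `q`, where `q` is padded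
by zeros to length `n - 1`. It has length `n` only if `q.card + 1 ≤ n`. -/
def hubSeq (n i : ℕ) (q : Multiset ℕ) : Multiset ℕ :=
  i ::ₘ (q + Multiset.replicate (n - 1 - q.card) 0).map (· + 2)

theorem sum_map_add_const (s : Multiset ℕ) (k : ℕ) :
    (s.map (· + k)).sum = s.sum + k * s.card := by
  rw [Multiset.sum_map_add, Multiset.map_id', Multiset.map_const', Multiset.sum_replicate,
    smul_eq_mul, mul_comm]

theorem card_le_sum_of_pos (hq : ∀ d ∈ q, 0 < d) : q.card ≤ q.sum := by
  simpa using Multiset.card_nsmul_le_sum (a := 1) hq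

theorem sum_hubSeq (hq : q.card ≤ n - 1) :
    (hubSeq n i q).sum = i + (q.sum + 2 * (n - 1)) := by
  simp only [hubSeq, Multiset.sum_cons, sum_map_add_const, Multiset.sum_add,
    Multiset.sum_replicate, Multiset.card_add, Multiset.card_replicate, smul_zero, add_zero,
    Nat.add_sub_cancel' hq]

theorem mem_hubSeq (hd : d ∈ hubSeq n i q) : d = i ∨ 2 ≤ d ∧ d ≤ q.sum + 2 := by
  refine (Multiset.mem_cons.1 hd).imp_right fun hd => ?_
  obtain ⟨e, he, rfl⟩ := Multiset.mem_map.1 hd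
  have : e ≤ q.sum := by
    rcases Multiset.mem_add.1 he with he | he
    · exact Multiset.le_sum_of_mem he
    · exact (Multiset.eq_of_mem_replicate he).trans_le (Nat.zero_le _)
  omega

theorem hubSeq_mem_D₀ (hi : i < n) (hcard : q.card ≤ i) (hsum : q.sum + 4 ≤ i)
    (hpar : q.sum % 2 = i % 2) : hubSeq n i q ∈ D₀ n := by
  obtain ⟨m, rfl⟩ := Nat.exists_eq_add_of_lt hi
  set r := q + Multiset.replicate (i - q.card) 0 with hr
  have hrc : r.card = i := by
    rw [hr, Multiset.card_add, Multiset.card_replicate, Nat.add_sub_cancel' hcard]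
  have hrs : r.sum = q.sum := by simp [hr]
  set f := r.map (· + 1) + Multiset.replicate m 2 with hf
  have hfc : f.card = i + m := by simp [hf, hrc]
  have hfs : f.sum = q.sum + i + 2 * m := by
    rw [hf, Multiset.sum_add, sum_map_add_const, hrc, hrs, Multiset.sum_replicate, smul_eq_mul]
    ring
  have hfpos : ∀ d ∈ f, 1 ≤ d := fun d hd => by
    rcases Multiset.mem_add.1 hd with h | h
    · obtain ⟨e, -, rfl⟩ := Multiset.mem_map.1 h
      omega
    · exact (Multiset.eq_of_mem_replicate h).symm ▸ one_le_two
  have hforest : f ∈ D₀ (i + m) :=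
    hfc ▸ mem_D₀_card_of_sum_lt hfpos (by rw [hfs, Nat.even_iff]; omega) (by omega)
  have hsplit : hubSeq (i + m + 1) i q =
      (r.map (· + 1)).card ::ₘ ((r.map (· + 1)).map (· + 1) + Multiset.replicate m 2) := by
    rw [hubSeq, show i + m + 1 - 1 - q.card = i - q.card + m by omega, Multiset.replicate_add,
      ← add_assoc, ← hr, Multiset.map_add, Multiset.map_replicate, Multiset.map_map,
      Multiset.card_map, hrc]
    rfl
  exact hsplit ▸ card_cons_map_succ_add_mem_D₀ hforest

theorem hubSeq_mem_D₂_diff_Db (hi : i < n) (hcard : q.card ≤ q.sum) (hsum : q.sum + 4 ≤ i)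
    (hpar : q.sum % 2 = i % 2) : hubSeq n i q ∈ D₂ n \ Db n := by
  have htwo : ∀ d ∈ hubSeq n i q, 2 ≤ d := fun d hd => by
    have := mem_hubSeq hd
    omega
  refine ⟨⟨⟨hubSeq_mem_D₀ hi (by omega) hsum hpar, fun d hd => one_le_two.trans (htwo d hd)⟩,
    htwo⟩, fun hb => ?_⟩
  have := ((mem_Db_iff (by omega)).1 hb).2 i (Multiset.mem_cons_self _ _)
  rw [sum_hubSeq (by omega)] at this
  omega

theorem exists_eq_hubSeq (hs : ∀ d ∈ s, 2 ≤ d) (hcard : s.card = n) (hi : i ∈ s) :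
    ∃ q, (∀ d ∈ q, 0 < d) ∧ q.card ≤ n - 1 ∧ s = hubSeq n i q := by
  obtain ⟨r, rfl⟩ := Multiset.exists_cons_of_mem hi
  obtain ⟨q, rfl⟩ : ∃ q : Multiset ℕ, q.map (· + 2) = r := by
    refine ⟨r.map (· - 2), ?_⟩
    rw [Multiset.map_map]
    exact (Multiset.map_congr rfl fun d hd =>
      Nat.sub_add_cancel (hs d (Multiset.mem_cons_of_mem hd))).trans (Multiset.map_id r)
  have hsplit := Multiset.filter_add_not (0 < ·) q
  have hlen : (q.filter (0 < ·)).card + (q.filter (¬ 0 < ·)).card = n - 1 := by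
    rw [← Multiset.card_add, hsplit, ← hcard, Multiset.card_cons, Multiset.card_map]
    rfl
  have hzero : q.filter (¬ 0 < ·) =
      Multiset.replicate (n - 1 - (q.filter (0 < ·)).card) 0 :=
    Multiset.eq_replicate.2 ⟨by omega, fun d hd =>
      Nat.eq_zero_of_not_pos (Multiset.mem_filter.1 hd).2⟩
  refine ⟨q.filter (0 < ·), fun d hd => (Multiset.mem_filter.1 hd).2, by omega, ?_⟩
  rw [hubSeq, ← hzero, hsplit]

theorem exists_eq_hubSeq_of_mem_D₂_diff_Db (hn : 3 ≤ n) (hs : s ∈ D₂ n \ Db n) :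
    ∃ i q, i < n ∧ (∀ d ∈ q, 0 < d) ∧ q.sum + 4 ≤ i ∧ q.sum % 2 = i % 2 ∧ s = hubSeq n i q := by
  obtain ⟨h2, hb⟩ := hs
  obtain ⟨i, hi, hsum⟩ : ∃ i ∈ s, s.sum + 4 < 2 * n + 2 * i := by
    by_contra! h
    exact hb ((mem_Db_iff hn).2 ⟨h2, h⟩)
  have hin := lt_of_mem_D₀ h2.1.1 hi
  have heven := even_sum_of_mem_D₀ h2.1.1
  obtain ⟨q, hpos, hq, rfl⟩ := exists_eq_hubSeq h2.2 (card_of_mem_D₀ h2.1.1) hi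
  rw [sum_hubSeq hq] at hsum heven
  rw [Nat.even_iff] at heven
  exact ⟨i, q, hin, hpos, by omega, by omega, rfl⟩

theorem hubSeq_inj (hq : ∀ d ∈ q, 0 < d) (hq' : ∀ d ∈ q', 0 < d) (hi : q.sum + 2 < i)
    (hi' : q'.sum + 2 < i') (h : hubSeq n i q = hubSeq n i' q') : i = i' ∧ q = q' := by
  have hi_mem := mem_hubSeq (h ▸ Multiset.mem_cons_self i _ : i ∈ hubSeq n i' q')
  have hi'_mem := mem_hubSeq (h ▸ Multiset.mem_cons_self i' _ : i' ∈ hubSeq n i q)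
  obtain rfl : i = i' := by omega
  refine ⟨rfl, ?_⟩
  rw [hubSeq, hubSeq, Multiset.cons_inj_right] at h
  have hfilter := congrArg (Multiset.filter (0 < ·))
    (Multiset.map_injective (add_left_injective 2) h)
  have hzero (k : ℕ) : (Multiset.replicate k 0).filter (0 < ·) = 0 :=
    Multiset.filter_eq_nil.2 fun d hd => (Multiset.eq_of_mem_replicate hd).not_gt
  simpa only [Multiset.filter_add, Multiset.filter_eq_self.2 hq, Multiset.filter_eq_self.2 hq',
    hzero, add_zero] using hfilter

/-- The possible values of `q.sum` when `hubSeq n i q` is the degree sequence of a graph but not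
of a biconnected one. -/
def excess (i : ℕ) : Finset ℕ :=
  {j ∈ Finset.range (i - 3) | j % 2 = i % 2}

/-- The pairs of a large term and a partition that index the sequences in `D₂ n` which are not in
`Db n`. -/
def hubIndex (n : ℕ) : Finset (Σ _ : ℕ, Σ j : ℕ, Nat.Partition j) :=
  (Finset.Icc 4 (n - 1)).sigma fun i => (excess i).sigma fun _ => Finset.univ

theorem mem_hubIndex {j : ℕ} {π : Nat.Partition j} :
    ⟨i, j, π⟩ ∈ hubIndex n ↔ i < n ∧ j + 4 ≤ i ∧ j % 2 = i % 2 := by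
  simp only [hubIndex, excess, Finset.mem_sigma, Finset.mem_Icc, Finset.mem_filter,
    Finset.mem_range, Finset.mem_univ, and_true]
  omega

theorem card_hubIndex (n : ℕ) :
    (hubIndex n).card = ∑ i ∈ Finset.Icc 4 (n - 1), ∑ j ∈ excess i, p j := by
  simp only [hubIndex, Finset.card_sigma, Finset.card_univ, p]

theorem D₂_diff_Db_eq_image (hn : 3 ≤ n) :
    D₂ n \ Db n =
      (fun x : Σ _ : ℕ, Σ j : ℕ, Nat.Partition j => hubSeq n x.1 x.2.2.parts) '' ↑(hubIndex n) := by
  ext s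
  constructor
  · intro hs
    obtain ⟨i, q, hin, hpos, hsum, hpar, rfl⟩ := exists_eq_hubSeq_of_mem_D₂_diff_Db hn hs
    exact ⟨⟨i, q.sum, q, hpos _, rfl⟩, mem_hubIndex.2 ⟨hin, hsum, hpar⟩, rfl⟩
  · rintro ⟨⟨i, _, q, hpos, rfl⟩, hx, rfl⟩
    obtain ⟨hin, hsum, hpar⟩ := mem_hubIndex.1 hx
    exact hubSeq_mem_D₂_diff_Db hin (card_le_sum_of_pos fun _ => hpos) hsum hpar

theorem injOn_hubSeq (n : ℕ) :
    Set.InjOn (fun x : Σ _ : ℕ, Σ j : ℕ, Nat.Partition j => hubSeq n x.1 x.2.2.parts)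
      ↑(hubIndex n) := by
  rintro ⟨i, _, q, hpos, rfl⟩ hx ⟨i', _, q', hpos', rfl⟩ hx' h
  obtain ⟨-, hi, -⟩ := mem_hubIndex.1 hx
  obtain ⟨-, hi', -⟩ := mem_hubIndex.1 hx'
  obtain ⟨rfl, rfl⟩ := hubSeq_inj (i := i) (i' := i') (fun _ => hpos) (fun _ => hpos') (by omega)
    (by omega) h
  rfl

theorem ncard_D₂_eq (hn : 3 ≤ n) :
    (D₂ n).ncard = ∑ i ∈ Finset.Icc 4 (n - 1), ∑ j ∈ excess i, p j + (Db n).ncard := by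
  have hsub : Db n ⊆ D₂ n := fun s hs => ((mem_Db_iff hn).1 hs).1
  rw [← Set.ncard_sdiff_add_ncard_of_subset hsub (finite_sets n).2.2.1, D₂_diff_Db_eq_image hn,
    (injOn_hubSeq n).ncard_image, Set.ncard_coe_finset, card_hubIndex]

theorem excess_of_even (hi : 4 ≤ i) (he : Even i) :
    excess i = {j ∈ Finset.Icc 0 (i - 4) | Even j} := by
  ext j
  simp only [excess, Finset.mem_filter, Finset.mem_Icc, Finset.mem_range, Nat.even_iff] at he ⊢
  omega

theorem excess_of_not_even (hi : 4 ≤ i) (ho : ¬ Even i) :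
    excess i = {j ∈ Finset.Icc 1 (i - 4) | Odd j} := by
  ext j
  simp only [excess, Finset.mem_filter, Finset.mem_Icc, Finset.mem_range, Nat.even_iff,
    Nat.odd_iff] at ho ⊢
  omega

end HubSequences

end DegSeq

theorem mainTheorem8 (n : ℕ) (hn : 5 ≤ n) :
    ((DegSeq.D₂ n).ncard : ℤ) =
        (DegSeq.D n).ncard - (DegSeq.D₀ (n - 2)).ncard - (DegSeq.S n).ncard ∧
    ((DegSeq.Db n).ncard : ℤ) =
        (DegSeq.D₂ n).ncard -
          ∑ i ∈ Finset.Icc 4 (n - 1),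
            if Even i then ∑ j ∈ Finset.Icc 0 (i - 4) with Even j, (DegSeq.p j : ℤ)
            else ∑ j ∈ Finset.Icc 1 (i - 4) with Odd j, (DegSeq.p j : ℤ) := by
  have h3 : 3 ≤ n := by omega
  constructor
  · rw [DegSeq.ncard_D_eq h3]
    push_cast
    ring
  · rw [DegSeq.ncard_D₂_eq h3]
    push_cast
    rw [eq_sub_iff_add_eq', add_left_inj]
    refine Finset.sum_congr rfl fun i hi => ?_
    have h4 := (Finset.mem_Icc.1 hi).1
    split_ifs with he
    · rw [DegSeq.excess_of_even h4 he]
    · rw [DegSeq.excess_of_not_even h4 he]
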